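/- Let $n\in\mathbb N$, let $N$ be a set of $n$ agents and $M$ a set of $n$ items. A preference profile $R=(\succ_j)_{j\in N}$ gives each agent $j$ a strict linear order $\succ_j$ over $M$; the top item of $j$ in $S\subseteq M$ is the $\succ_j$-best item of $S$, and $U(\succ_j,o)=\{o'\in M: o'\succ_j o\}\cup\{o\}$. A deterministic assignment is a bijection $A:N\to M$, identified with its $0/1$ matrix; a random assignment is a doubly stochastic matrix $P=[p_{j,o}]_{j\in N,o\in M}$, with rows $P_j$. For $p,q\in\mathbb R^M$ write $p\succeq^{sd}_j q$ if $\sum_{o'\in U(\succ_j,o)}p_{o'}\ge\sum_{o'\in U(\succ_j,o)}q_{o'}$ for all $o\in M$. A mechanism maps every profile to a random assignment. The eager Boston mechanism (EBM) starts with all items and all agents remaining. While items remain, it plays a round: every remaining agent applies for her top item among the remaining items; for each remaining item $o$ with a nonempty set $N_o$ of applicants, an agent drawn uniformly at random from $N_o$, independently across lotteries, is allocated $o$; then all items that had applicants and all winners are removed. Let $\mathbb E(\mathrm{EBM}(R))$ be the matrix whose $(j,o)$ entry is the probability that $j$ is allocated $o$. For a deterministic assignment $A$ define recursively, for $r=1,2,\dots$,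 the set $T_{A,r}$ of the items $o$ such that $o$ is the top item in $M\setminus\bigcup_{r'<r}T_{A,r'}$ of some agent $j$ with $A(j)\notin\bigcup_{r'<r}T_{A,r'}$. The assignment $A$ satisfies FERI (favoring-eagerness-for-remaining-items) if, for every $r\ge1$, every $o\in T_{A,r}$ is the top item in $M\setminus\bigcup_{r'<r}T_{A,r'}$ of the agent $A^{-1}(o)$. The common prefix of $\succ_j$ and $\succ_k$ is the longest sequence of items that is an initial segment of both orders. **Theorem.** For every profile $R$, the matrix $P=\mathbb E(\mathrm{EBM}(R))$ is a random assignment such that 1. (ex-post FERI) $P$ is a convex combination of deterministic assignments that satisfy FERI; 2. (sd-weak-envy-freeness) for all $j,k\in N$, if $P_k\succeq^{sd}_j P_j$ then $P_j=P_k$; 3. (strong equal treatment of equals) for all $j,k\in N$, $p_{j,o}=p_{k,o}$ for every item $o$ in the common prefix of $\succ_j$ and $\succ_k$. Moreover, EBM is sd-weakly strategyproof: for every profile $R$, every agent $j$ and every profile $R'$ obtained from $R$ by replacing $\succ_j$ by some strict linear order $\succ'_j$ over $M$, if $\mathbb E(\mathrm{EBM}(R'))_j\succeq^{sd}_j\mathbb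 E(\mathrm{EBM}(R))_j$ (dominance with respect to $\succ_j$), then $\mathbb E(\mathrm{EBM}(R'))_j=\mathbb E(\mathrm{EBM}(R))_j$. -/

import Mathlib

/-! ## Assignment problems with `n` agents and `n` items -/

abbrev Agent (n : ℕ) : Type := Fin n

abbrev Item (n : ℕ) : Type := Fin n

/-- A strict linear order over the items; `prefers a b` reads `a ≻ b`. -/
structure Preference (n : ℕ) where
  prefers : Item n → Item n → Prop
  strictLinear : IsStrictTotalOrder (Item n) prefers

abbrev Profile (n : ℕ) : Type := Agent n → Preference n

namespace Preference

variable {n : ℕ}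

open Classical in
/-- Upper contour set `{o' | o' ≻ o} ∪ {o}`. -/
noncomputable def upperContour (p : Preference n) (o : Item n) : Finset (Item n) :=
  Finset.univ.filter fun o' => p.prefers o' o ∨ o' = o

/-- The rank of an item: the best item has rank `1`. -/
noncomputable def rank (p : Preference n) (o : Item n) : ℕ := (p.upperContour o).card

/-- `o` is the item ranked highest among the items of `S` (no such item exists if `S` is empty). -/
def IsTop (p : Preference n) (S : Finset (Item n)) (o : Item n) : Prop :=
  o ∈ S ∧ ∀ o' ∈ S, o' ≠ o → p.prefers o o'

/-- `C` is the set of items that appear in the common prefix of `p` and `q`: its items have in both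
orders the same rank, which is at most `|C|`, and the top items outside `C` (if any) differ. -/
def IsCommonPrefix (p q : Preference n) (C : Finset (Item n)) : Prop :=
  (∀ o ∈ C, p.rank o = q.rank o ∧ p.rank o ≤ C.card) ∧
    ∀ o o', p.IsTop Cᶜ o → q.IsTop Cᶜ o' → o ≠ o'

/-- `x` (weakly) stochastically dominates `y` with respect to `p`. -/
def StochDom (p : Preference n) (x y : Item n → ℝ) : Prop :=
  ∀ o, ∑ o' ∈ p.upperContour o, y o' ≤ ∑ o' ∈ p.upperContour o, x o'

end Preference

/-! ## Deterministic and random assignments, mechanisms -/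

/-- A one-to-one mapping from agents to items. -/
abbrev DetAssignment (n : ℕ) : Type := Agent n ≃ Item n

abbrev ShareMatrix (n : ℕ) : Type := Matrix (Agent n) (Item n) ℝ

def DetAssignment.toMatrix {n : ℕ} (A : DetAssignment n) : ShareMatrix n :=
  fun j o => if A j = o then 1 else 0

/-- A random assignment is a doubly stochastic matrix. -/
def IsRandomAssignment {n : ℕ} (P : ShareMatrix n) : Prop :=
  P ∈ doublyStochastic ℝ (Fin n)

/-- `P` is a convex combination of deterministic assignments with the property `X`. -/
def ExPost {n : ℕ} (X : DetAssignment n → Prop) (P : ShareMatrix n) : Prop :=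
  P ∈ convexHull ℝ (DetAssignment.toMatrix '' {A | X A})

section FERI

variable {n : ℕ}

open Classical in
/-- Given the set `U` of items in the earlier tiers, the items `o ∉ U` that are the top item outside
`U` of some agent whose own item is not in `U`. -/
noncomputable def nextTier (R : Profile n) (A : DetAssignment n) (U : Finset (Item n)) :
    Finset (Item n) :=
  Finset.univ.filter fun o => ∃ j, A j ∉ U ∧ (R j).IsTop Uᶜ o

/-- The union of the first `r` tiers. -/
noncomputable def tiersBefore (R : Profile n) (A : DetAssignment n) : ℕ → Finset (Item n)
  | 0 => ∅
  | r + 1 => tiersBefore R A r ∪ nextTier R A (tiersBefore R A r)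

/-- The tier number `r + 1`, i.e. the tiers are numbered from `0` here. -/
noncomputable def tier (R : Profile n) (A : DetAssignment n) (r : ℕ) : Finset (Item n) :=
  nextTier R A (tiersBefore R A r)

/-- Favoring-eagerness-for-remaining-items: every item of every tier is assigned to an agent for
whom it is the top item outside the earlier tiers. -/
def FERI (R : Profile n) (A : DetAssignment n) : Prop :=
  ∀ r, ∀ o ∈ tier R A r, (R (A.symm o)).IsTop (tiersBefore R A r)ᶜ o

end FERI

/-- No agent's allocation is dominated by a different allocation of another agent. -/
def SdWeakEnvyFree {n : ℕ} (R : Profile n) (P : ShareMatrix n) : Prop :=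
  ∀ j k, (R j).StochDom (P k) (P j) → P j = P k

/-- Any two agents have the same shares of the items in the common prefix of their preferences. -/
def StrongEqualTreatmentOfEquals {n : ℕ} (R : Profile n) (P : ShareMatrix n) : Prop :=
  ∀ j k C, (R j).IsCommonPrefix (R k) C → ∀ o ∈ C, P j o = P k o

/-- No misreport `p` of an agent `j` yields her an allocation that dominates, with respect to her
true preference `R j`, the one for the truthful report and differs from it. -/
def SdWeakStrategyproof {n : ℕ} (f : Profile n → ShareMatrix n) : Prop :=
  ∀ (R : Profile n) (j : Agent n) (p : Preference n),
    (R j).StochDom (f (Function.update R j p) j) (f R j) → f (Function.update R j p) j = f R j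

/-! ## The eager Boston mechanism -/

/-- Independent draws: one from each of the distributions `d i`. -/
noncomputable def independentDraws {ι α : Type} [Fintype ι] [DecidableEq ι] [Fintype α]
    (d : ι → PMF α) : PMF (ι → α) :=
  PMF.ofFintype (fun w => ∏ i, d i (w i)) (by
    rw [← Fintype.prod_sum]
    refine Finset.prod_eq_one fun i _ => ?_
    rw [← tsum_fintype (L := .unconditional _)]
    exact (d i).tsum_coe)

namespace EBM

variable {n : ℕ}

/-- The variables of the algorithm: the remaining items, the remaining agents, and the item (if any)
that each agent has been allocated. -/
structure State (n : ℕ) where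
  items : Finset (Item n)
  agents : Finset (Agent n)
  alloc : Agent n → Option (Item n)

def State.initial : State n := ⟨Finset.univ, Finset.univ, fun _ => none⟩

open Classical in
/-- The remaining agents who apply for `o`. -/
noncomputable def State.applicants (R : Profile n) (s : State n) (o : Item n) : Finset (Agent n) :=
  s.agents.filter fun j => (R j).IsTop s.items o

open Classical in
/-- The winner of a lottery among the agents of `S`, drawn uniformly at random; there is no winner
(`none`) if `S` is empty. -/
noncomputable def lottery (S : Finset (Agent n)) : PMF (Option (Agent n)) :=
  if h : S.Nonempty then (PMF.uniformOfFinset S h).map some else PMF.pure none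

open Classical in
/-- The end of a round in which the item `o` was won by `winner o`. -/
noncomputable def State.update (R : Profile n) (s : State n)
    (winner : Item n → Option (Agent n)) : State n where
  items := s.items.filter fun o => s.applicants R o = ∅
  agents := s.agents.filter fun j => ∀ o, winner o ≠ some j
  alloc := fun j => if h : ∃ o, winner o = some j then some h.choose else s.alloc j

/-- One round: independent lotteries for all the items, each among the applicants for it. -/
noncomputable def round (R : Profile n) (s : State n) : PMF (State n) :=
  (independentDraws fun o => lottery (s.applicants R o)).map (s.update R)

/-- The loop that plays rounds while items remain, cut off after the given number of rounds. -/
noncomputable def loop (R : Profile n) : ℕ → State n → PMF (State n)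
  | 0, s => PMF.pure s
  | r + 1, s => if s.items = ∅ then PMF.pure s else (round R s).bind (loop R r)

/-- The distribution of the outcome. Every round allocates an item, so `n` rounds suffice. -/
noncomputable def outcome (R : Profile n) : PMF (Agent n → Option (Item n)) :=
  (loop R n State.initial).map State.alloc

/-- The expected outcome: the entry at `(j, o)` is the probability that `j` is allocated `o`. -/
noncomputable def expectedOutcome (R : Profile n) : ShareMatrix n :=
  fun j o => ∑ A, (outcome R A).toReal * if A j = some o then 1 else 0

end EBM

/-! ## Expectations over finite types -/

/-! Envy-freeness, equal treatment and strategyproofness all come from one coupling,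
`share_sub_share_mem`. It compares an agent `j` with report `p` in one problem with `σ j`, reporting
`q`, in a second problem. While `p` and `q` have the same top among the remaining items, the
applicant sets of the two problems correspond under `σ`. The lotteries can then be coupled so that
either both agents win the same item or both stay in play.

At the first round where the tops `a` of `p` and `b` of `q` differ, `j` applies for `a` and `σ j`
does not. If someone applies for `a` in the second problem, `σ j` can no longer get it, whereas `j`
gets it with positive probability. If nobody does, `j` is the sole applicant and gets `a` for sure.
Items that `p` ranks above `a` are gone by then, so the difference of the expected rows is
lexicographically nonnegative for `p`. It also vanishes on the common prefix, all of which is gone.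
Both conditions define convex cones (`lexCone`, `vanishingCone`), so they survive averaging over the
draws. `ConeDiverges` isolates what the induction needs of a cone.

A lexicographically nonnegative difference excludes reverse dominance unless the rows are equal.
Taking `σ` to be the swap of two agents within one profile gives the two fairness properties; the
identity with a changed report gives strategyproofness.

For FERI, the items removed in each round of a run are exactly the next tier of its outcome. Every
run thus ends in a FERI assignment, and the expected outcome is a mixture of these, hence doubly
stochastic. -/

/-- The expectation of a vector-valued function on a finite probability space. -/
noncomputable def PMF.expect {α E : Type} [Fintype α] [AddCommGroup E] [Module ℝ E]
    (μ : PMF α) (f : α → E) : E :=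
  ∑ a, (μ a).toReal • f a

namespace PMF

variable {α β E : Type} [Fintype α] [Fintype β] [AddCommGroup E] [Module ℝ E]

theorem sum_toReal (μ : PMF α) : ∑ a, (μ a).toReal = 1 := by
  rw [← ENNReal.toReal_sum fun a _ => μ.apply_ne_top a, ← tsum_fintype (L := .unconditional _),
    μ.tsum_coe, ENNReal.toReal_one]

theorem expect_congr {μ : PMF α} {f g : α → E} (h : ∀ a ∈ μ.support, f a = g a) :
    μ.expect f = μ.expect g := by
  refine Finset.sum_congr rfl fun a _ => ?_
  by_cases ha : a ∈ μ.support
  · rw [h a ha]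
  · rw [(μ.apply_eq_zero_iff a).2 ha]; simp

theorem expect_const (μ : PMF α) (x : E) : μ.expect (fun _ => x) = x := by
  rw [expect, ← Finset.sum_smul, μ.sum_toReal, one_smul]

theorem expect_eq_of_forall {μ : PMF α} {f : α → E} {x : E} (h : ∀ a ∈ μ.support, f a = x) :
    μ.expect f = x :=
  (expect_congr h).trans (μ.expect_const x)

theorem expect_sub (μ : PMF α) (f g : α → E) :
    μ.expect f - μ.expect g = μ.expect fun a => f a - g a := by
  simp only [expect, smul_sub, Finset.sum_sub_distrib]

theorem expect_pure (a : α) (f : α → E) : (PMF.pure a).expect f = f a :=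
  expect_eq_of_forall fun b hb => by rw [(mem_support_pure_iff a b).1 hb]

theorem expect_bind (μ : PMF α) (κ : α → PMF β) (f : β → E) :
    (μ.bind κ).expect f = μ.expect fun a => (κ a).expect f := by
  simp only [expect, Finset.smul_sum, smul_smul]
  rw [Finset.sum_comm]
  refine Finset.sum_congr rfl fun b _ => ?_
  rw [← Finset.sum_smul, bind_apply, tsum_fintype, ENNReal.toReal_sum fun a _ =>
    ENNReal.mul_ne_top (μ.apply_ne_top a) ((κ a).apply_ne_top b)]
  simp only [ENNReal.toReal_mul]

theorem expect_map (μ : PMF α) (g : α → β) (f : β → E) :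
    (μ.map g).expect f = μ.expect fun a => f (g a) := by
  rw [← bind_pure_comp, expect_bind]
  simp only [Function.comp_apply, expect_pure]

/-- Reduces a comparison of expectations to one for each possible draw of the coupled lotteries. -/
theorem expect_mem (K : PointedCone ℝ E) {μ : PMF α} {f : α → E}
    (h : ∀ a ∈ μ.support, f a ∈ K) : μ.expect f ∈ K := by
  refine K.sum_mem fun a _ => ?_
  by_cases ha : a ∈ μ.support
  · exact K.smul_mem ENNReal.toReal_nonneg (h a ha)
  · rw [(μ.apply_eq_zero_iff a).2 ha]; simp

theorem expect_apply {ι : Type} (μ : PMF α) (f : α → ι → ℝ) (i : ι) :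
    μ.expect f i = μ.expect fun a => f a i := by
  simp [expect]

theorem expect_nonneg (μ : PMF α) {f : α → ℝ} (h : ∀ a, 0 ≤ f a) : 0 ≤ μ.expect f :=
  Finset.sum_nonneg fun a _ => mul_nonneg ENNReal.toReal_nonneg (h a)

theorem expect_le_one (μ : PMF α) {f : α → ℝ} (h : ∀ a, f a ≤ 1) : μ.expect f ≤ 1 := by
  rw [← μ.sum_toReal]
  exact Finset.sum_le_sum fun a _ => mul_le_of_le_one_right ENNReal.toReal_nonneg (h a)

theorem expect_pos {μ : PMF α} {f : α → ℝ} (h : ∀ a, 0 ≤ f a) {a : α} (ha : a ∈ μ.support)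
    (hfa : 0 < f a) : 0 < μ.expect f :=
  Finset.sum_pos' (fun b _ => mul_nonneg ENNReal.toReal_nonneg (h b))
    ⟨a, Finset.mem_univ a, mul_pos
      (ENNReal.toReal_pos ((μ.mem_support_iff a).1 ha) (μ.apply_ne_top a)) hfa⟩

end PMF

theorem independentDraws_apply {ι α : Type} [Fintype ι] [DecidableEq ι] [Fintype α]
    (d : ι → PMF α) (w : ι → α) : independentDraws d w = ∏ i, d i (w i) := rfl

theorem mem_support_independentDraws {ι α : Type} [Fintype ι] [DecidableEq ι] [Fintype α]
    {d : ι → PMF α} {w : ι → α} :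
    w ∈ (independentDraws d).support ↔ ∀ i, w i ∈ (d i).support := by
  simp [PMF.mem_support_iff, independentDraws_apply, Finset.prod_eq_zero_iff]

/-! ## Preferences -/

namespace Preference

variable {n : ℕ} {p q : Preference n}

theorem irrefl (p : Preference n) (a : Item n) : ¬ p.prefers a a :=
  p.strictLinear.toIrrefl.irrefl a

theorem trans {a b c : Item n} (h₁ : p.prefers a b) (h₂ : p.prefers b c) : p.prefers a c :=
  p.strictLinear.toIsTrans.trans a b c h₁ h₂

theorem asymm {a b : Item n} (h₁ : p.prefers a b) (h₂ : p.prefers b a) : False :=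
  p.irrefl a (trans h₁ h₂)

theorem trichotomy (p : Preference n) (a b : Item n) :
    p.prefers a b ∨ a = b ∨ p.prefers b a := by
  have := p.strictLinear
  exact trichotomous_of p.prefers a b

theorem wellFounded (p : Preference n) : WellFounded p.prefers := by
  have := p.strictLinear
  exact Finite.wellFounded_of_trans_of_irrefl p.prefers

theorem IsTop.unique {S : Finset (Item n)} {a b : Item n} (ha : p.IsTop S a)
    (hb : p.IsTop S b) : a = b := by
  by_contra h
  exact asymm (ha.2 b hb.1 (Ne.symm h)) (hb.2 a ha.1 h)

theorem exists_isTop (p : Preference n) {S : Finset (Item n)} (hS : S.Nonempty) :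
    ∃ a, p.IsTop S a := by
  obtain ⟨a, ha, hmin⟩ := p.wellFounded.has_min (S : Set (Item n)) hS
  refine ⟨a, ha, fun b hb hne => ?_⟩
  rcases p.trichotomy a b with h | h | h
  · exact h
  · exact absurd h.symm hne
  · exact absurd h (hmin b hb)

theorem IsTop.notMem_of_prefers {S : Finset (Item n)} {a b : Item n} (ha : p.IsTop S a)
    (h : p.prefers b a) : b ∉ S := fun hb =>
  asymm h (ha.2 b hb fun e => p.irrefl a (e ▸ h))

theorem mem_upperContour {a b : Item n} : b ∈ p.upperContour a ↔ p.prefers b a ∨ b = a := by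
  simp [upperContour]

theorem rank_lt_rank {a b : Item n} (h : p.prefers a b) : p.rank a < p.rank b := by
  refine Finset.card_lt_card ⟨fun c hc => ?_, fun hsub => ?_⟩
  · rcases mem_upperContour.1 hc with hc | rfl
    · exact mem_upperContour.2 (.inl (trans hc h))
    · exact mem_upperContour.2 (.inl h)
  · rcases mem_upperContour.1 (hsub (mem_upperContour.2 (.inr rfl))) with h' | rfl
    · exact asymm h h'
    · exact p.irrefl _ h

theorem rank_injective (p : Preference n) : Function.Injective p.rank := fun a b h => by
  rcases p.trichotomy a b with h' | h' | h'
  · exact absurd h (rank_lt_rank h').ne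
  · exact h'
  · exact absurd h (rank_lt_rank h').ne'

theorem rank_pos (p : Preference n) (a : Item n) : 0 < p.rank a :=
  Finset.card_pos.2 ⟨a, mem_upperContour.2 (.inr rfl)⟩

theorem IsTop.rank_le {S : Finset (Item n)} {a b : Item n} (ha : p.IsTop S a) (hb : b ∈ S) :
    p.rank a ≤ p.rank b := by
  rcases eq_or_ne b a with rfl | hne
  · exact le_rfl
  · exact (rank_lt_rank (ha.2 b hb hne)).le

/-- A set of items whose ranks do not exceed its cardinality is an initial segment. -/
theorem mem_of_rank_le_card {C : Finset (Item n)} (hC : ∀ o ∈ C, p.rank o ≤ C.card)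
    {a : Item n} (ha : p.rank a ≤ C.card) : a ∈ C := by
  by_contra hmem
  -- Pigeonhole: `|C| + 1` distinct ranks would have to fit into `[1, |C|]`.
  have hle : ((insert a C).image p.rank).card ≤ (Finset.Icc 1 C.card).card := by
    refine Finset.card_le_card fun m hm => ?_
    obtain ⟨o, ho, rfl⟩ := Finset.mem_image.1 hm
    refine Finset.mem_Icc.2 ⟨p.rank_pos o, ?_⟩
    rcases Finset.mem_insert.1 ho with rfl | ho
    · exact ha
    · exact hC o ho
  rw [Finset.card_image_of_injective _ p.rank_injective, Finset.card_insert_of_notMem hmem,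
    Nat.card_Icc] at hle
  omega

/-- A surviving prefix item would bound the ranks of both tops by `|C|` and so place both tops in
`C`. There the two orders assign equal ranks, so the tops would coincide. -/
theorem IsCommonPrefix.disjoint_of_isTop_ne {C S : Finset (Item n)} {a b c : Item n}
    (hC : p.IsCommonPrefix q C) (ha : p.IsTop S a) (hb : q.IsTop S b) (hab : a ≠ b)
    (hc : c ∈ C) : c ∉ S := by
  intro hcS
  have hp := hC.1 c hc
  have haC : a ∈ C := mem_of_rank_le_card (fun o ho => (hC.1 o ho).2)
    ((ha.rank_le hcS).trans hp.2)
  have hbC : b ∈ C := mem_of_rank_le_card (p := q)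
    (fun o ho => (hC.1 o ho).1 ▸ (hC.1 o ho).2) ((hb.rank_le hcS).trans (hp.1 ▸ hp.2))
  have h₁ := ha.rank_le hb.1
  have h₂ := hb.rank_le ha.1
  rw [← (hC.1 a haC).1, ← (hC.1 b hbC).1] at h₂
  exact hab (p.rank_injective (le_antisymm h₁ h₂))

/-! ### Cones for comparing expected rows -/

/-- The cone of the vectors that are lexicographically nonnegative with respect to `p`. -/
def lexCone (p : Preference n) : PointedCone ℝ (Item n → ℝ) where
  carrier := {v | v = 0 ∨ ∃ o, 0 < v o ∧ ∀ o', p.prefers o' o → v o' = 0}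
  zero_mem' := .inl rfl
  add_mem' := by
    rintro v w (rfl | ⟨a, ha, hva⟩) (rfl | ⟨b, hb, hwb⟩)
    · exact .inl (add_zero 0)
    · rw [zero_add]; exact .inr ⟨b, hb, hwb⟩
    · rw [add_zero]; exact .inr ⟨a, ha, hva⟩
    -- The leading coordinate of the sum is at the better of `a` and `b`.
    · right
      rcases p.trichotomy a b with h | rfl | h
      · exact ⟨a, by simpa [hwb a h] using ha, fun o ho => by
          simp [hva o ho, hwb o (trans ho h)]⟩
      · exact ⟨a, add_pos ha hb, fun o ho => by simp [hva o ho, hwb o ho]⟩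
      · exact ⟨b, by simpa [hva b h] using hb, fun o ho => by
          simp [hwb o ho, hva o (trans ho h)]⟩
  smul_mem' := by
    rintro ⟨c, hc⟩ v (rfl | ⟨a, ha, hva⟩)
    · exact .inl (smul_zero _)
    · rcases hc.eq_or_lt with rfl | hc
      · exact .inl (by ext; simp [Nonneg.mk_smul])
      · exact .inr ⟨a, by simpa [Nonneg.mk_smul] using mul_pos hc ha, fun o ho => by
          simp [hva o ho]⟩

/-- At the best item where the vectors differ, `x` is larger, so the sum over that upper contour set
contradicts dominance by `y`. -/
theorem StochDom.eq_of_sub_mem_lexCone {x y : Item n → ℝ} (h : p.StochDom y x)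
    (hlex : x - y ∈ p.lexCone) : x = y := by
  rcases hlex with h₀ | ⟨o, ho, heq⟩
  · exact sub_eq_zero.1 h₀
  · exfalso
    refine (h o).not_gt (Finset.sum_lt_sum (fun o' ho' => ?_)
      ⟨o, mem_upperContour.2 (.inr rfl), sub_pos.1 ho⟩)
    rcases mem_upperContour.1 ho' with h' | rfl
    · exact (sub_eq_zero.1 (heq o' h')).ge
    · exact (sub_pos.1 ho).le

/-- The cone `K` contains `x - y` whenever `x` and `y` are subprobability vectors over a set `S` on
which the tops of `p` and `q` differ, and either `x` but not `y` has a share in the `p`-top of `S`,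
or `x` is all of it. -/
def ConeDiverges (p q : Preference n) (K : PointedCone ℝ (Item n → ℝ)) : Prop :=
  ∀ (S : Finset (Item n)) (a b : Item n), p.IsTop S a → q.IsTop S b → a ≠ b →
    ∀ x y : Item n → ℝ, (∀ o ∉ S, x o = 0) → (∀ o ∉ S, y o = 0) → 0 ≤ y → ∑ o, y o ≤ 1 →
      (0 < x a ∧ y a = 0 ∨ x = Pi.single a 1) → x - y ∈ K

/-- Everything better than `a` lies outside `S`, so `a` is the first coordinate that can differ. A
tie there is possible only when `x` is all of `a`; then `y` has no mass left for other items and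
equals `x`. -/
theorem coneDiverges_lexCone (p q : Preference n) : ConeDiverges p q p.lexCone := by
  intro S a b ha _ _ x y hx hy hy0 hy1 h
  have hlt (hxy : y a < x a) : x - y ∈ p.lexCone :=
    .inr ⟨a, sub_pos.2 hxy, fun o ho => by
      have := ha.notMem_of_prefers ho
      simp [hx o this, hy o this]⟩
  rcases h with ⟨h₁, h₂⟩ | rfl
  · exact hlt (h₂ ▸ h₁)
  · by_cases hya : y a < 1
    · exact hlt (by simpa using hya)
    · left
      ext o
      rw [← Finset.add_sum_erase _ _ (Finset.mem_univ a)] at hy1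
      have hrest : ∑ o ∈ Finset.univ.erase a, y o = 0 :=
        le_antisymm (by linarith) (Finset.sum_nonneg fun o _ => hy0 o)
      have hzero := (Finset.sum_eq_zero_iff_of_nonneg fun o _ => hy0 o).1 hrest
      rcases eq_or_ne o a with rfl | hne
      · simp only [Pi.sub_apply, Pi.single_eq_same, Pi.zero_apply]
        linarith
      · simp [hne, hzero o (by simp [hne])]

/-- The cone of the vectors that vanish on `C`. -/
def vanishingCone (C : Finset (Item n)) : PointedCone ℝ (Item n → ℝ) where
  carrier := {v | ∀ o ∈ C, v o = 0}
  zero_mem' := fun _ _ => rfl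
  add_mem' := fun hv hw o ho => by simp [hv o ho, hw o ho]
  smul_mem' := fun c v hv o ho => by simp [hv o ho]

theorem IsCommonPrefix.coneDiverges {C : Finset (Item n)} (hC : p.IsCommonPrefix q C) :
    ConeDiverges p q (vanishingCone C) := by
  intro S a b ha hb hab x y hx hy _ _ _ o ho
  have := hC.disjoint_of_isTop_ne ha hb hab ho
  simp [hx o this, hy o this]

end Preference
/-! ## The rounds of the eager Boston mechanism -/

namespace EBM

variable {n : ℕ}

theorem State.ext_fields {s t : State n} (h₁ : s.items = t.items) (h₂ : s.agents = t.agents)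
    (h₃ : s.alloc = t.alloc) : s = t := by
  cases s; cases t; simp_all

noncomputable instance : Fintype (State n) :=
  Fintype.ofInjective (fun s : State n => (s.items, s.agents, s.alloc)) fun s t h => by
    simp only [Prod.mk.injEq] at h
    exact State.ext_fields h.1 h.2.1 h.2.2

theorem State.mem_applicants {R : Profile n} {s : State n} {o : Item n} {j : Agent n} :
    j ∈ s.applicants R o ↔ j ∈ s.agents ∧ (R j).IsTop s.items o := by
  simp [State.applicants]

/-! ### Lottery probabilities and possible draws -/

theorem lottery_some (S : Finset (Agent n)) (i : Agent n) :
    lottery S (some i) = if i ∈ S then (S.card : ENNReal)⁻¹ else 0 := by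
  classical
  by_cases h : S.Nonempty
  · simp only [lottery, h, dif_pos, PMF.map_apply, Option.some_inj]
    rw [tsum_eq_single i fun b hb => if_neg hb.symm]
    simp [PMF.uniformOfFinset_apply]
  · have hi : i ∉ S := fun hi => h ⟨i, hi⟩
    simp [lottery, h, hi]

theorem lottery_none (S : Finset (Agent n)) :
    lottery S none = if S = ∅ then 1 else 0 := by
  by_cases h : S.Nonempty
  · simp [lottery, h, PMF.map_apply, h.ne_empty]
  · simp [lottery, Finset.not_nonempty_iff_eq_empty.1 h]

theorem lottery_map (S : Finset (Agent n)) (σ : Equiv.Perm (Agent n)) (v : Option (Agent n)) :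
    lottery (S.map σ.toEmbedding) (v.map σ) = lottery S v := by
  cases v with
  | none => simp [lottery_none]
  | some i => simp [lottery_some]

/-- The possible results of the lotteries in the state `s`. -/
def IsDraw (R : Profile n) (s : State n) (w : Item n → Option (Agent n)) : Prop :=
  (∀ o i, w o = some i → i ∈ s.applicants R o) ∧ ∀ o, w o = none → s.applicants R o = ∅

theorem mem_support_draws {R : Profile n} {s : State n} {w : Item n → Option (Agent n)} :
    w ∈ (independentDraws fun o => lottery (s.applicants R o)).support ↔ IsDraw R s w := by
  rw [mem_support_independentDraws, IsDraw, ← forall_and]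
  refine forall_congr' fun o => ?_
  rw [PMF.mem_support_iff]
  cases h : w o with
  | none => simp [lottery_none]
  | some i => simp [lottery_some]

theorem exists_isDraw {R : Profile n} {s : State n} {a : Item n} {j : Agent n}
    (hj : j ∈ s.applicants R a) : ∃ w, IsDraw R s w ∧ w a = some j := by
  classical
  have hex (o : Item n) : ∃ v : Option (Agent n), (∀ i, v = some i → i ∈ s.applicants R o) ∧
      (v = none → s.applicants R o = ∅) := by
    rcases (s.applicants R o).eq_empty_or_nonempty with h | ⟨i, hi⟩
    · exact ⟨none, by simp, fun _ => h⟩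
    · exact ⟨some i, by simpa using hi, by simp⟩
  choose w hw using hex
  refine ⟨Function.update w a (some j), ⟨fun o i h => ?_, fun o h => ?_⟩, by simp⟩
  · by_cases ho : o = a
    · subst ho; simp at h; exact h ▸ hj
    · exact (hw o).1 i (by simpa [ho] using h)
  · by_cases ho : o = a
    · subst ho; simp at h
    · exact (hw o).2 (by simpa [ho] using h)

section Update

variable {R : Profile n} {s : State n} {w : Item n → Option (Agent n)} {j : Agent n} {o : Item n}

theorem State.mem_update_items :
    o ∈ (s.update R w).items ↔ o ∈ s.items ∧ s.applicants R o = ∅ := by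
  simp [State.update]

theorem State.mem_update_agents :
    j ∈ (s.update R w).agents ↔ j ∈ s.agents ∧ ∀ o, w o ≠ some j := by
  simp [State.update]

theorem IsDraw.mem_agents (hw : IsDraw R s w) (h : w o = some j) : j ∈ s.agents :=
  (State.mem_applicants.1 (hw.1 o j h)).1

theorem IsDraw.isTop (hw : IsDraw R s w) (h : w o = some j) : (R j).IsTop s.items o :=
  (State.mem_applicants.1 (hw.1 o j h)).2

/-- The choice made in `State.update` is harmless: an agent wins only an item she applied for, and
her top item is unique. -/
theorem IsDraw.alloc_of_wins (hw : IsDraw R s w) (h : w o = some j) :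
    (s.update R w).alloc j = some o := by
  have hex : ∃ o, w o = some j := ⟨o, h⟩
  simp only [State.update, hex, dif_pos, Option.some_inj]
  exact (hw.isTop hex.choose_spec).unique (hw.isTop h)

theorem State.alloc_of_loses (h : ∀ o, w o ≠ some j) :
    (s.update R w).alloc j = s.alloc j := by
  simp [State.update, h]

theorem IsDraw.alloc_of_notMem (hw : IsDraw R s w) (hj : j ∉ s.agents) :
    (s.update R w).alloc j = s.alloc j :=
  State.alloc_of_loses fun _ h => hj (hw.mem_agents h)

end Update

theorem mem_support_loop_succ {R : Profile n} {r : ℕ} {s t : State n}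
    (ht : t ∈ (loop R (r + 1) s).support) :
    s.items = ∅ ∧ t = s ∨
      s.items ≠ ∅ ∧ ∃ w, IsDraw R s w ∧ t ∈ (loop R r (s.update R w)).support := by
  rw [loop] at ht
  split_ifs at ht with h
  · exact .inl ⟨h, (PMF.mem_support_pure_iff _ _).1 ht⟩
  · refine .inr ⟨h, ?_⟩
    rw [PMF.mem_support_bind_iff] at ht
    obtain ⟨u, hu, ht⟩ := ht
    rw [round, PMF.mem_support_map_iff] at hu
    obtain ⟨w, hw, rfl⟩ := hu
    exact ⟨w, mem_support_draws.1 hw, ht⟩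

theorem alloc_eq_of_mem_support_loop {R : Profile n} {j : Agent n} (r : ℕ) {s t : State n}
    (ht : t ∈ (loop R r s).support) (hj : j ∉ s.agents) : t.alloc j = s.alloc j := by
  induction r generalizing s with
  | zero => rw [(PMF.mem_support_pure_iff _ _).1 ht]
  | succ r ih =>
    rcases mem_support_loop_succ ht with ⟨_, rfl⟩ | ⟨_, w, hw, ht⟩
    · rfl
    · rw [ih ht fun h => hj (State.mem_update_agents.1 h).1, hw.alloc_of_notMem hj]

theorem mem_items_of_mem_support_loop {R : Profile n} {j : Agent n} {o : Item n} (r : ℕ)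
    {s t : State n} (ht : t ∈ (loop R r s).support) (hj : s.alloc j = none)
    (ho : t.alloc j = some o) : o ∈ s.items := by
  induction r generalizing s with
  | zero =>
    rw [(PMF.mem_support_pure_iff _ _).1 ht, hj] at ho
    simp at ho
  | succ r ih =>
    rcases mem_support_loop_succ ht with ⟨_, rfl⟩ | ⟨_, w, hw, ht⟩
    · rw [hj] at ho; simp at ho
    · by_cases hwin : ∃ a, w a = some j
      · obtain ⟨a, ha⟩ := hwin
        have hout : j ∉ (s.update R w).agents := fun h => (State.mem_update_agents.1 h).2 a ha
        rw [alloc_eq_of_mem_support_loop r ht hout, hw.alloc_of_wins ha, Option.some_inj] at ho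
        exact ho ▸ (hw.isTop ha).1
      · push Not at hwin
        exact (State.mem_update_items.1
          (ih ht (by rw [State.alloc_of_loses hwin, hj]))).1

/-! ## Expected shares -/

/-- The `0/1` row of an agent who is allocated `x`. -/
def allocRow (x : Option (Item n)) : Item n → ℝ := fun o => if x = some o then 1 else 0

theorem allocRow_none : allocRow (none : Option (Item n)) = 0 := by
  ext; simp [allocRow]

theorem allocRow_some (a : Item n) : allocRow (some a) = Pi.single a 1 := by
  ext o
  simp [allocRow, Pi.single_apply, eq_comm]

theorem allocRow_nonneg (x : Option (Item n)) (o : Item n) : 0 ≤ allocRow x o := by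
  rw [allocRow]; split_ifs <;> norm_num

theorem sum_allocRow_le_one (x : Option (Item n)) : ∑ o, allocRow x o ≤ 1 := by
  cases x <;> simp [allocRow]

/-- The expected row of agent `j` after at most `r` rounds from the state `s`. -/
noncomputable def share (R : Profile n) (r : ℕ) (s : State n) (j : Agent n) : Item n → ℝ :=
  (loop R r s).expect fun t => allocRow (t.alloc j)

theorem expectedOutcome_eq_share (R : Profile n) (j : Agent n) :
    expectedOutcome R j = share R n State.initial j := by
  ext o
  rw [share, PMF.expect_apply,
    ← PMF.expect_map (loop R n State.initial) State.alloc fun A => allocRow (A j) o]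
  rfl

theorem share_of_items_eq_empty {R : Profile n} {r : ℕ} {s : State n} {j : Agent n}
    (hs : s.items = ∅) : share R r s j = allocRow (s.alloc j) := by
  cases r with
  | zero => exact PMF.expect_pure _ _
  | succ r => rw [share, loop, if_pos hs, PMF.expect_pure]

theorem share_succ {R : Profile n} {r : ℕ} {s : State n} {j : Agent n} (hs : s.items ≠ ∅) :
    share R (r + 1) s j = (independentDraws fun o => lottery (s.applicants R o)).expect
      fun w => share R r (s.update R w) j := by
  rw [share, loop, if_neg hs, PMF.expect_bind, round, PMF.expect_map]
  rfl

theorem share_of_notMem_agents {R : Profile n} {r : ℕ} {s : State n} {j : Agent n}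
    (hj : j ∉ s.agents) : share R r s j = allocRow (s.alloc j) :=
  PMF.expect_eq_of_forall fun t ht => by rw [alloc_eq_of_mem_support_loop r ht hj]

theorem share_eq_zero {R : Profile n} {r : ℕ} {s : State n} {j : Agent n} {o : Item n}
    (hj : s.alloc j = none) (ho : o ∉ s.items) : share R r s j o = 0 := by
  rw [share, PMF.expect_apply]
  exact PMF.expect_eq_of_forall fun t ht => if_neg fun h =>
    ho (mem_items_of_mem_support_loop r ht hj h)

theorem share_nonneg (R : Profile n) (r : ℕ) (s : State n) (j : Agent n) (o : Item n) :
    0 ≤ share R r s j o := by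
  rw [share, PMF.expect_apply]
  exact PMF.expect_nonneg _ fun t => allocRow_nonneg _ o

theorem sum_share_le_one (R : Profile n) (r : ℕ) (s : State n) (j : Agent n) :
    ∑ o, share R r s j o ≤ 1 := by
  have h : ∑ o, share R r s j o = (loop R r s).expect fun t => ∑ o, allocRow (t.alloc j) o := by
    simp only [share, PMF.expect, Finset.sum_apply, Pi.smul_apply, smul_eq_mul, Finset.mul_sum]
    exact Finset.sum_comm
  rw [h]
  exact PMF.expect_le_one _ fun t => sum_allocRow_le_one _

theorem IsDraw.share_of_wins {R : Profile n} {r : ℕ} {s : State n}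
    {w : Item n → Option (Agent n)} (hw : IsDraw R s w) {j : Agent n} {a : Item n}
    (h : w a = some j) : share R r (s.update R w) j = Pi.single a 1 := by
  rw [share_of_notMem_agents fun hj => (State.mem_update_agents.1 hj).2 a h,
    hw.alloc_of_wins h, allocRow_some]

/-- Some draw lets `j` win at once. The horizon `r + 1` ensures that this round is played. -/
theorem share_pos_of_applicant {R : Profile n} {r : ℕ} {s : State n} {j : Agent n} {a : Item n}
    (hj : j ∈ s.applicants R a) : 0 < share R (r + 1) s j a := by
  have hs : s.items ≠ ∅ := Finset.ne_empty_of_mem (State.mem_applicants.1 hj).2.1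
  obtain ⟨w, hw, hwin⟩ := exists_isDraw hj
  rw [share_succ hs, PMF.expect_apply]
  exact PMF.expect_pos (fun w => share_nonneg _ _ _ _ _) (mem_support_draws.2 hw)
    (by rw [hw.share_of_wins hwin]; simp)

theorem share_of_sole_applicant {R : Profile n} {r : ℕ} {s : State n} {j : Agent n} {a : Item n}
    (h : s.applicants R a = {j}) : share R (r + 1) s j = Pi.single a 1 := by
  have hj : j ∈ s.applicants R a := by simp [h]
  have hs : s.items ≠ ∅ := Finset.ne_empty_of_mem (State.mem_applicants.1 hj).2.1
  rw [share_succ hs]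
  refine PMF.expect_eq_of_forall fun w hw => ?_
  rw [mem_support_draws] at hw
  cases hwa : w a with
  | none => simp [hw.2 a hwa] at h
  | some i =>
    have hi := hw.1 a i hwa
    rw [h, Finset.mem_singleton] at hi
    exact hw.share_of_wins (hi ▸ hwa)

/-- An item that has applicants is out of reach of the others. -/
theorem share_eq_zero_of_other_applicant {R : Profile n} {r : ℕ} {s : State n} {i j : Agent n}
    {a : Item n} (hi : i ∈ s.applicants R a) (hj : j ∉ s.applicants R a)
    (hnone : s.alloc j = none) : share R (r + 1) s j a = 0 := by
  have hs : s.items ≠ ∅ := Finset.ne_empty_of_mem (State.mem_applicants.1 hi).2.1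
  rw [share_succ hs, PMF.expect_apply]
  refine PMF.expect_eq_of_forall fun w hw => ?_
  rw [mem_support_draws] at hw
  by_cases hwin : ∃ o, w o = some j
  · obtain ⟨o, ho⟩ := hwin
    have hne : a ≠ o := fun e => hj (e ▸ hw.1 o j ho)
    rw [hw.share_of_wins ho, Pi.single_eq_of_ne hne]
  · push Not at hwin
    refine share_eq_zero (by rw [State.alloc_of_loses hwin, hnone]) fun h => ?_
    rw [(State.mem_update_items.1 h).2] at hi
    simp at hi

/-! ## Permuting the agents -/

/-- The coupling: relabelling winners by `σ` is a bijection of the draws that preserves their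
probabilities, since a uniform lottery depends only on the size of its applicant set. -/
theorem expect_draws_permute {R R' : Profile n} {s s' : State n} {σ : Equiv.Perm (Agent n)}
    (h : ∀ o, s'.applicants R' o = (s.applicants R o).map σ.toEmbedding)
    (f : (Item n → Option (Agent n)) → Item n → ℝ) :
    (independentDraws fun o => lottery (s'.applicants R' o)).expect f =
      (independentDraws fun o => lottery (s.applicants R o)).expect
        fun w => f fun o => (w o).map σ := by
  refine (Fintype.sum_equiv (Equiv.piCongrRight fun _ => Equiv.optionCongr σ) _ _
    fun w => ?_).symm
  have hmap : (Equiv.piCongrRight fun _ => Equiv.optionCongr σ) w = fun o => (w o).map σ := rfl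
  simp only [hmap, independentDraws_apply, h, lottery_map]

/-- The comparison of an agent `j` whose report is `p` with her counterpart `σ j` in a permuted
problem, whose report is `q`; some other agent may have the report `q` here and `p` there. -/
theorem share_sub_share_mem {p q : Preference n} {K : PointedCone ℝ (Item n → ℝ)}
    (hK : Preference.ConeDiverges p q K) {R R' : Profile n} {σ : Equiv.Perm (Agent n)}
    {j : Agent n} (hp : R j = p) (hq : R' (σ j) = q) (r : ℕ) {s s' : State n}
    (hitems : s'.items = s.items) (hagents : s'.agents = s.agents.map σ.toEmbedding)
    (hj : j ∈ s.agents) (hnone : s.alloc j = none) (hnone' : s'.alloc (σ j) = none)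
    (hothers : ∀ i ∈ s.agents, i ≠ j → R' (σ i) = R i ∨ R i = q ∧ R' (σ i) = p) :
    share R r s j - share R' r s' (σ j) ∈ K := by
  induction r generalizing s s' with
  | zero =>
    have h₁ : share R 0 s j = 0 := by
      rw [share, loop, PMF.expect_pure, hnone, allocRow_none]
    have h₂ : share R' 0 s' (σ j) = 0 := by
      rw [share, loop, PMF.expect_pure, hnone', allocRow_none]
    rw [h₁, h₂, sub_zero]
    exact K.zero_mem
  | succ r ih =>
    by_cases hs : s.items = ∅
    · rw [share_of_items_eq_empty hs, share_of_items_eq_empty (hitems.trans hs), hnone, hnone',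
        sub_self]
      exact K.zero_mem
    have hs' : s'.items ≠ ∅ := hitems ▸ hs
    obtain ⟨a, ha⟩ := p.exists_isTop (Finset.nonempty_iff_ne_empty.2 hs)
    obtain ⟨b, hb⟩ := q.exists_isTop (Finset.nonempty_iff_ne_empty.2 hs)
    have hmem (i : Agent n) : σ i ∈ s'.agents ↔ i ∈ s.agents := by simp [hagents]
    -- With equal tops, reports `p` and `q` are indistinguishable in this round, so exchanging them
    -- leaves the applicants the same up to `σ`.
    by_cases hab : a = b
    · subst hab
      have htop (o : Item n) : p.IsTop s.items o ↔ q.IsTop s.items o :=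
        ⟨fun h => h.unique ha ▸ hb, fun h => h.unique hb ▸ ha⟩
      have happ (o : Item n) : s'.applicants R' o = (s.applicants R o).map σ.toEmbedding := by
        ext i
        obtain ⟨i, rfl⟩ := σ.surjective i
        rw [State.mem_applicants, hmem, hitems]
        simp only [Finset.mem_map_equiv, Equiv.symm_apply_apply, State.mem_applicants]
        refine and_congr_right fun hi => ?_
        rcases eq_or_ne i j with rfl | hij
        · rw [hp, hq, htop]
        · rcases hothers i hi hij with h | ⟨h₁, h₂⟩
          · rw [h]
          · rw [h₁, h₂, htop]
      rw [share_succ hs, share_succ hs', expect_draws_permute happ, PMF.expect_sub]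
      refine PMF.expect_mem K fun w hw => ?_
      rw [mem_support_draws] at hw
      have hwin (o : Item n) (i : Agent n) : (w o).map σ = some (σ i) ↔ w o = some i := by
        cases w o <;> simp
      have hw' : IsDraw R' s' fun o => (w o).map σ := by
        refine ⟨fun o i h => ?_, fun o h => ?_⟩
        · obtain ⟨i, rfl⟩ := σ.surjective i
          rw [happ]
          simpa using hw.1 o i ((hwin o i).1 h)
        · rw [happ, hw.2 o (by simpa using h)]
          rfl
      by_cases hwj : ∃ o, w o = some j
      · obtain ⟨o, ho⟩ := hwj
        rw [hw.share_of_wins ho, hw'.share_of_wins (a := o) ((hwin o j).2 ho), sub_self]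
        exact K.zero_mem
      · push Not at hwj
        -- Both agents lose, and the updated states are again related by `σ`.
        refine ih ?_ ?_ (State.mem_update_agents.2 ⟨hj, hwj⟩)
          (by rw [State.alloc_of_loses hwj, hnone])
          (by rw [State.alloc_of_loses fun o h => hwj o ((hwin o j).1 h), hnone'])
          fun i hi => hothers i (State.mem_update_agents.1 hi).1
        · ext o
          rw [State.mem_update_items, State.mem_update_items, happ, hitems, Finset.map_eq_empty]
        · ext i
          obtain ⟨i, rfl⟩ := σ.surjective i
          rw [State.mem_update_agents, hmem]
          simp only [Finset.mem_map_equiv, Equiv.symm_apply_apply, State.mem_update_agents]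
          simp only [ne_eq, hwin]
    · refine hK s.items a b ha hb hab _ _ (fun o ho => share_eq_zero hnone ho)
        (fun o ho => share_eq_zero hnone' (hitems ▸ ho)) (fun o => share_nonneg _ _ _ _ _)
        (sum_share_le_one _ _ _ _) ?_
      have hja : j ∈ s.applicants R a := State.mem_applicants.2 ⟨hj, hp ▸ ha⟩
      have hja' : σ j ∉ s'.applicants R' a := fun h => by
        have h := (State.mem_applicants.1 h).2
        rw [hq, hitems] at h
        exact hab (h.unique hb)
      -- If `a` has no applicant in the second problem, a rival of `j` for `a` in the first cannot
      -- have an unchanged report; it would report `q`, whose top is `b`.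
      by_cases hex : ∃ i, i ∈ s'.applicants R' a
      · obtain ⟨i, hi⟩ := hex
        exact .inl ⟨share_pos_of_applicant hja, share_eq_zero_of_other_applicant hi hja' hnone'⟩
      · right
        refine share_of_sole_applicant (Finset.eq_singleton_iff_unique_mem.2 ⟨hja, fun i hi => ?_⟩)
        by_contra hij
        obtain ⟨hi, hia⟩ := State.mem_applicants.1 hi
        rcases hothers i hi hij with h | ⟨h, -⟩
        · exact hex ⟨σ i, State.mem_applicants.2 ⟨(hmem i).2 hi, by rwa [h, hitems]⟩⟩
        · rw [h] at hia
          exact hab (hb.unique hia).symm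

theorem expectedOutcome_sub_mem {p q : Preference n} {K : PointedCone ℝ (Item n → ℝ)}
    (hK : Preference.ConeDiverges p q K) {R R' : Profile n} (σ : Equiv.Perm (Agent n))
    {j : Agent n} (hp : R j = p) (hq : R' (σ j) = q)
    (hothers : ∀ i, i ≠ j → R' (σ i) = R i ∨ R i = q ∧ R' (σ i) = p) :
    expectedOutcome R j - expectedOutcome R' (σ j) ∈ K := by
  rw [expectedOutcome_eq_share, expectedOutcome_eq_share]
  exact share_sub_share_mem hK hp hq n rfl (by simp [State.initial]) (Finset.mem_univ j) rfl rfl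
    fun i _ => hothers i

/-- Under the swap, `k` is the other agent whose report changes from `q` to `p`. -/
theorem expectedOutcome_sub_mem_of_agents {R : Profile n} {j k : Agent n}
    {K : PointedCone ℝ (Item n → ℝ)} (hK : Preference.ConeDiverges (R j) (R k) K) :
    expectedOutcome R j - expectedOutcome R k ∈ K := by
  have h := expectedOutcome_sub_mem (R := R) (R' := R) hK (Equiv.swap j k) (j := j) rfl
    (by rw [Equiv.swap_apply_left]) fun i hij => by
      rcases eq_or_ne i k with rfl | hik
      · exact .inr ⟨rfl, by rw [Equiv.swap_apply_right]⟩
      · exact .inl (by rw [Equiv.swap_apply_of_ne_of_ne hij hik])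
  rwa [Equiv.swap_apply_left] at h

/-! ### Consequences of the coupling -/

theorem sdWeakEnvyFree_expectedOutcome (R : Profile n) :
    SdWeakEnvyFree R (expectedOutcome R) := fun j k h =>
  h.eq_of_sub_mem_lexCone
    (expectedOutcome_sub_mem_of_agents (Preference.coneDiverges_lexCone (R j) (R k)))

theorem strongEqualTreatmentOfEquals_expectedOutcome (R : Profile n) :
    StrongEqualTreatmentOfEquals R (expectedOutcome R) := fun _ _ _ hC o ho =>
  sub_eq_zero.1 (expectedOutcome_sub_mem_of_agents hC.coneDiverges o ho)

theorem sdWeakStrategyproof_expectedOutcome :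
    SdWeakStrategyproof (expectedOutcome : Profile n → ShareMatrix n) := fun R j p h =>
  (h.eq_of_sub_mem_lexCone (expectedOutcome_sub_mem
    (Preference.coneDiverges_lexCone (R j) p) (Equiv.refl _) rfl (by simp)
    fun i hij => .inl (by simp [hij]))).symm

/-! ## Ex-post FERI -/

/-! ### Consistency of states and termination -/

/-- The allocation matches the agents who are gone with the items that are gone. -/
structure State.Consistent (s : State n) : Prop where
  mem_agents_iff : ∀ j, j ∈ s.agents ↔ s.alloc j = none
  mem_items_iff : ∀ o, o ∈ s.items ↔ ∀ j, s.alloc j ≠ some o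
  alloc_inj : ∀ i j o, s.alloc i = some o → s.alloc j = some o → i = j

theorem State.consistent_initial : (State.initial : State n).Consistent :=
  ⟨by simp [State.initial], by simp [State.initial], by simp [State.initial]⟩

theorem State.Consistent.update {R : Profile n} {s : State n} (hs : s.Consistent)
    {w : Item n → Option (Agent n)} (hw : IsDraw R s w) : (s.update R w).Consistent := by
  have halloc (j : Agent n) (o : Item n) :
      (s.update R w).alloc j = some o ↔ w o = some j ∨ s.alloc j = some o := by
    by_cases hwin : ∃ a, w a = some j
    · obtain ⟨a, ha⟩ := hwin
      rw [hw.alloc_of_wins ha, (hs.mem_agents_iff j).1 (hw.mem_agents ha), Option.some_inj]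
      refine ⟨fun h => .inl (h ▸ ha), fun h => ?_⟩
      rcases h with h | h
      · exact (hw.isTop ha).unique (hw.isTop h)
      · simp at h
    · push Not at hwin
      rw [State.alloc_of_loses hwin]
      exact ⟨.inr, fun h => h.resolve_left (hwin o)⟩
  refine ⟨fun j => ?_, fun o => ?_, fun i j o hi hj => ?_⟩
  · rw [State.mem_update_agents, hs.mem_agents_iff, Option.eq_none_iff_forall_ne_some,
      Option.eq_none_iff_forall_ne_some]
    simp only [ne_eq, halloc, not_or, forall_and]
    exact and_comm
  · rw [State.mem_update_items, hs.mem_items_iff]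
    simp only [ne_eq, halloc, not_or, forall_and]
    rw [and_comm]
    refine and_congr_left fun _ => ⟨fun h j hj => ?_, fun h => ?_⟩
    · simpa [h] using hw.1 o j hj
    · refine hw.2 o (Option.eq_none_iff_forall_ne_some.2 h)
  · rw [halloc] at hi hj
    rcases hi with hi | hi <;> rcases hj with hj | hj
    · exact Option.some_inj.1 (hi.symm.trans hj)
    · exact absurd hj ((hs.mem_items_iff o).1 (hw.isTop hi).1 j)
    · exact absurd hi ((hs.mem_items_iff o).1 (hw.isTop hj).1 i)
    · exact hs.alloc_inj i j o hi hj

/-- If every agent held an item, the injective allocation would exhaust all `n` items. -/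
theorem State.Consistent.agents_nonempty {s : State n} (hs : s.Consistent) (h : s.items ≠ ∅) :
    s.agents.Nonempty := by
  by_contra hempty
  have hsome (j : Agent n) : ∃ o, s.alloc j = some o := Option.ne_none_iff_exists'.1 fun hj =>
    hempty ⟨j, (hs.mem_agents_iff j).2 hj⟩
  choose A hA using hsome
  have hinj : Function.Injective A := fun i j hij =>
    hs.alloc_inj i j (A i) (hA i) (hij ▸ hA j)
  obtain ⟨o, ho⟩ := Finset.nonempty_iff_ne_empty.2 h
  obtain ⟨j, rfl⟩ := (Finite.injective_iff_surjective.1 hinj) o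
  exact (hs.mem_items_iff _).1 ho j (hA j)

/-- The top item of any remaining agent is removed. Hence the cutoff after `n` rounds never
truncates a run. -/
theorem State.Consistent.card_update_items_lt {R : Profile n} {s : State n} (hs : s.Consistent)
    (h : s.items ≠ ∅) (w : Item n → Option (Agent n)) :
    (s.update R w).items.card < s.items.card := by
  obtain ⟨j, hj⟩ := hs.agents_nonempty h
  obtain ⟨a, ha⟩ := (R j).exists_isTop (Finset.nonempty_iff_ne_empty.2 h)
  refine Finset.card_lt_card ⟨fun o ho => (State.mem_update_items.1 ho).1, fun hsub => ?_⟩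
  have hmem : j ∈ s.applicants R a := State.mem_applicants.2 ⟨hj, ha⟩
  rw [(State.mem_update_items.1 (hsub ha.1)).2] at hmem
  simp at hmem

theorem consistent_of_mem_support_loop {R : Profile n} (r : ℕ) {s t : State n}
    (hs : s.Consistent) (hr : s.items.card ≤ r) (ht : t ∈ (loop R r s).support) :
    t.Consistent ∧ t.items = ∅ := by
  induction r generalizing s with
  | zero =>
    rw [(PMF.mem_support_pure_iff _ _).1 ht]
    exact ⟨hs, Finset.card_eq_zero.1 (Nat.le_zero.1 hr)⟩
  | succ r ih =>
    rcases mem_support_loop_succ ht with ⟨h, rfl⟩ | ⟨h, w, hw, ht⟩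
    · exact ⟨hs, h⟩
    · refine ih (hs.update hw) ?_ ht
      have := hs.card_update_items_lt (R := R) h w
      omega

theorem State.Consistent.exists_assignment {t : State n} (ht : t.Consistent)
    (hempty : t.items = ∅) : ∃ A : DetAssignment n, ∀ j, t.alloc j = some (A j) := by
  have hex (o : Item n) : ∃ j, t.alloc j = some o := by
    by_contra! h
    simpa [hempty] using (ht.mem_items_iff o).2 h
  choose B hB using hex
  have hinj : Function.Injective B := fun o o' h =>
    Option.some_inj.1 ((hB o).symm.trans ((congrArg t.alloc h).trans (hB o')))
  refine ⟨(Equiv.ofBijective B (Finite.injective_iff_bijective.1 hinj)).symm, fun j => ?_⟩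
  obtain ⟨o, rfl⟩ := (Finite.injective_iff_surjective.1 hinj) j
  rw [hB, Option.some_inj, Equiv.eq_symm_apply]
  rfl

/-! ### Rounds of a run as tiers of its outcome -/

theorem mem_nextTier {R : Profile n} {A : DetAssignment n} {U : Finset (Item n)} {o : Item n} :
    o ∈ nextTier R A U ↔ ∃ j, A j ∉ U ∧ (R j).IsTop Uᶜ o := by
  simp [nextTier]

theorem tiersBefore_mono {R : Profile n} {A : DetAssignment n} : Monotone (tiersBefore R A) :=
  monotone_nat_of_le_succ fun _ => Finset.subset_union_left

/-- The invariant `hr` says that the items gone so far are the first `r` tiers. Each round preserves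
it with `r + 1`, until the tier `r'` is the one being played and its items go to applicants. -/
theorem tier_of_mem_support_loop {R : Profile n} {A : DetAssignment n} {t : State n}
    (hA : ∀ j, t.alloc j = some (A j)) (m : ℕ) {s : State n}
    (hs : s.Consistent) (hm : s.items.card ≤ m) (ht : t ∈ (loop R m s).support) {r : ℕ}
    (hr : tiersBefore R A r = s.itemsᶜ) {r' : ℕ} (hr' : r ≤ r') {o : Item n}
    (ho : o ∈ tier R A r') : (R (A.symm o)).IsTop (tiersBefore R A r')ᶜ o := by
  -- Once all items are gone, every later tier is empty, contradicting `ho`.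
  have hdone {s : State n} {r : ℕ} (hr : tiersBefore R A r = s.itemsᶜ) (hr' : r ≤ r')
      (h : s.items = ∅) : (R (A.symm o)).IsTop (tiersBefore R A r')ᶜ o := by
    obtain ⟨j, hj, -⟩ := mem_nextTier.1 ho
    exact absurd (tiersBefore_mono hr' (by simp [hr, h])) hj
  induction m generalizing s r with
  | zero => exact hdone hr hr' (Finset.card_eq_zero.1 (Nat.le_zero.1 hm))
  | succ m ih =>
    rcases mem_support_loop_succ ht with ⟨h, -⟩ | ⟨h, w, hw, ht'⟩
    · exact hdone hr hr' h
    -- An agent who is gone keeps her removed item, and a remaining one ends up with a remaining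
    -- item. Hence the agents who define the tier are those who apply now.
    have hagent (j : Agent n) : A j ∉ s.itemsᶜ ↔ j ∈ s.agents := by
      rw [Finset.mem_compl, not_not]
      refine ⟨fun hj => ?_, fun hj =>
        mem_items_of_mem_support_loop _ ht ((hs.mem_agents_iff j).1 hj) (hA j)⟩
      by_contra hout
      exact (hs.mem_items_iff _).1 hj j (by rw [← alloc_eq_of_mem_support_loop _ ht hout, hA])
    have htier (a : Item n) : a ∈ tier R A r ↔ (s.applicants R a).Nonempty := by
      rw [tier, mem_nextTier, hr]
      simp only [hagent, compl_compl, Finset.Nonempty, State.mem_applicants]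
    rcases hr'.eq_or_lt with rfl | hlt
    · rw [hr, compl_compl]
      cases hwo : w o with
      | none => exact absurd (hw.2 o hwo) (Finset.nonempty_iff_ne_empty.1 ((htier o).1 ho))
      | some j =>
        have hout : j ∉ (s.update R w).agents := fun hj => (State.mem_update_agents.1 hj).2 o hwo
        have hj := alloc_eq_of_mem_support_loop _ ht' hout
        rw [hA, hw.alloc_of_wins hwo, Option.some_inj] at hj
        rw [← hj, A.symm_apply_apply, hj]
        exact hw.isTop hwo
    · have hcard := hs.card_update_items_lt (R := R) h w
      have hnext : tiersBefore R A (r + 1) = (s.update R w).itemsᶜ := by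
        ext a
        have := htier a
        rw [tier] at this
        rw [tiersBefore, Finset.mem_union, this, hr, Finset.mem_compl, Finset.mem_compl,
          State.mem_update_items, not_and_or, Finset.nonempty_iff_ne_empty]
      exact ih (hs.update hw) (by omega) ht' hnext hlt

theorem exists_feri_of_mem_support {R : Profile n} {t : State n}
    (ht : t ∈ (loop R n State.initial).support) :
    ∃ A : DetAssignment n, FERI R A ∧ ∀ j, t.alloc j = some (A j) := by
  have hcard : (State.initial : State n).items.card ≤ n := by simp [State.initial]
  obtain ⟨hc, hempty⟩ := consistent_of_mem_support_loop n State.consistent_initial hcard ht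
  obtain ⟨A, hA⟩ := hc.exists_assignment hempty
  exact ⟨A, fun r o ho => tier_of_mem_support_loop hA n State.consistent_initial hcard ht (r := 0)
    (by simp [tiersBefore, State.initial]) (Nat.zero_le r) ho, hA⟩

theorem exPost_feri_expectedOutcome (R : Profile n) : ExPost (FERI R) (expectedOutcome R) := by
  classical
  -- Off the support `A t` is an arbitrary assignment, so the convex combination runs over the
  -- support only.
  choose! A hA using fun t => exists_feri_of_mem_support (R := R) (t := t)
  set μ := loop R n State.initial
  have hP : expectedOutcome R =
      ∑ t with t ∈ μ.support, (μ t).toReal • (A t).toMatrix := by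
    ext j o
    rw [expectedOutcome_eq_share, share, PMF.expect_apply, PMF.expect, Finset.sum_filter,
      Matrix.sum_apply]
    change ∑ t, (μ t).toReal • allocRow (t.alloc j) o = _
    refine Finset.sum_congr rfl fun t _ => ?_
    split_ifs with ht
    · simp [allocRow, (hA t ht).2 j, DetAssignment.toMatrix]
    · simp [(μ.apply_eq_zero_iff t).2 ht]
  rw [ExPost, hP]
  refine (convex_convexHull ℝ _).sum_mem (fun _ _ => ENNReal.toReal_nonneg) ?_ fun t ht =>
    subset_convexHull ℝ _ ⟨A t, (hA t (Finset.mem_filter.1 ht).2).1, rfl⟩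
  rw [← μ.sum_toReal, Finset.sum_filter]
  refine Finset.sum_congr rfl fun t _ => ?_
  split_ifs with ht
  · rfl
  · simp [(μ.apply_eq_zero_iff t).2 ht]

end EBM

/-- Convex combinations of deterministic assignments are random assignments. -/
theorem ExPost.isRandomAssignment {n : ℕ} {X : DetAssignment n → Prop} {P : ShareMatrix n}
    (h : ExPost X P) : IsRandomAssignment P := by
  refine convexHull_min ?_ convex_doublyStochastic h
  rintro _ ⟨A, -, rfl⟩
  refine mem_doublyStochastic_iff_sum.2 ⟨fun j o => ?_, fun j => ?_, fun o => ?_⟩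
  · rw [DetAssignment.toMatrix]; split_ifs <;> norm_num
  · simp [DetAssignment.toMatrix]
  · simp [DetAssignment.toMatrix, ← Equiv.eq_symm_apply]

/-- The expected outcome of the eager Boston mechanism is a random assignment that satisfies ex-post
FERI, sd-weak-envy-freeness and strong equal treatment of equals, for every preference profile, and
the mechanism is sd-weakly strategyproof. -/
theorem mainTheorem1 (n : ℕ) :
    (∀ R : Profile n,
      IsRandomAssignment (EBM.expectedOutcome R) ∧
      ExPost (FERI R) (EBM.expectedOutcome R) ∧
      SdWeakEnvyFree R (EBM.expectedOutcome R) ∧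
      StrongEqualTreatmentOfEquals R (EBM.expectedOutcome R)) ∧
    SdWeakStrategyproof (EBM.expectedOutcome : Profile n → ShareMatrix n) := by
  exact ⟨fun R => ⟨(EBM.exPost_feri_expectedOutcome R).isRandomAssignment,
    EBM.exPost_feri_expectedOutcome R, EBM.sdWeakEnvyFree_expectedOutcome R,
    EBM.strongEqualTreatmentOfEquals_expectedOutcome R⟩,
    EBM.sdWeakStrategyproof_expectedOutcome⟩
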